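/- Let $\mathcal{M}$ be a finite set of indivisible items and let $1 \le n \le 8$. Suppose that there are $n$ agents, and that every agent $i \in \{1,\dots,n\}$ has a valuation function $v_i : 2^{\mathcal{M}} \to \mathbb{R}$ that is normalized ($v_i(\emptyset)=0$), monotone ($v_i(S)\le v_i(T)$ whenever $S\subseteq T\subseteq\mathcal{M}$) and subadditive ($v_i(S\cup T)\le v_i(S)+v_i(T)$ for all $S,T\subseteq\mathcal{M}$). Let $$\mathrm{MMS}(\mathcal{M},v_i,n)=\max_{(P_1,\dots,P_n)}\ \min_{1\le j\le n} v_i(P_j)$$ be the maximin share of agent $i$, where the maximum is over all partitions of $\mathcal{M}$ into $n$ disjoint (possibly empty) bundles. Then there is a $\frac16$-MMS allocation: there are pairwise disjoint sets $A_1,\dots,A_n\subseteq\mathcal{M}$ such that $v_i(A_i)\ge\frac16\,\mathrm{MMS}(\mathcal{M},v_i,n)$ for every agent $i$. -/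

import Mathlib

namespace FairAllocation

/-- A normalized, monotone, subadditive valuation over the finite item set `M`. -/
structure IsSubadditiveValuation {M : Type*} [DecidableEq M] (v : Finset M → ℝ) : Prop where
  normalized : v ∅ = 0
  monotone : ∀ S T : Finset M, S ⊆ T → v S ≤ v T
  subadditive : ∀ S T : Finset M, v (S ∪ T) ≤ v S + v T

/-- An allocation to `n` agents: pairwise disjoint bundles (items may remain unallocated). -/
def IsAllocation {M : Type*} {n : ℕ} (A : Fin n → Finset M) : Prop :=
  ∀ i j : Fin n, i ≠ j → Disjoint (A i) (A j)

/-- A partition of the items into `n` disjoint, possibly empty, bundles. -/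
def IsPartition {M : Type*} {n : ℕ} (P : Fin n → Finset M) : Prop :=
  IsAllocation P ∧ ∀ e : M, ∃ j : Fin n, e ∈ P j

/-- The maximin share: the maximum, over partitions into `n` bundles, of the smallest
bundle value. For `n ≥ 1` the maximum is attained, see `isGreatest_mms`. -/
noncomputable def mms {M : Type*} (v : Finset M → ℝ) (n : ℕ) : ℝ :=
  sSup {r : ℝ | ∃ P : Fin n → Finset M, IsPartition P ∧ r = ⨅ j, v (P j)}

theorem isGreatest_mms {M : Type*} [Fintype M] (v : Finset M → ℝ) (n : ℕ) (hn : 1 ≤ n) :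
    IsGreatest {r : ℝ | ∃ P : Fin n → Finset M, IsPartition P ∧ IsLeast (Set.range (v ∘ P)) r}
      (mms v n) := by
  classical
  have : Nonempty (Fin n) := ⟨⟨0, hn⟩⟩
  have key : ∀ (P : Fin n → Finset M) (r : ℝ),
      IsLeast (Set.range (v ∘ P)) r ↔ r = ⨅ j, v (P j) := by
    intro P r
    have h : IsLeast (Set.range (v ∘ P)) (⨅ j, v (P j)) :=
      ⟨(Set.range_nonempty (v ∘ P)).csInf_mem (Set.finite_range _),
        fun _ hx => csInf_le (Set.finite_range (v ∘ P)).bddBelow hx⟩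
    exact ⟨fun h' => h'.unique h, fun h' => h' ▸ h⟩
  simp only [key]
  have hne : {r : ℝ | ∃ P : Fin n → Finset M, IsPartition P ∧ r = ⨅ j, v (P j)}.Nonempty := by
    refine ⟨_, fun j => if j = ⟨0, hn⟩ then Finset.univ else ∅, ⟨?_, ?_⟩, rfl⟩
    · intro i j hij
      by_cases hi : i = ⟨0, hn⟩
      · have hj : j ≠ ⟨0, hn⟩ := fun h => hij (hi.trans h.symm)
        simp [hj]
      · simp [hi]
    · exact fun e => ⟨⟨0, hn⟩, by simp⟩
  have hfin : {r : ℝ | ∃ P : Fin n → Finset M, IsPartition P ∧ r = ⨅ j, v (P j)}.Finite := by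
    refine (Set.finite_range fun P : Fin n → Finset M => ⨅ j, v (P j)).subset ?_
    rintro r ⟨P, -, rfl⟩
    exact ⟨P, rfl⟩
  exact ⟨hne.csSup_mem hfin, fun _ hx => le_csSup hfin.bddAbove hx⟩

/-- A `ρ`-MMS allocation for agents with valuations `v` and equal entitlements. -/
def IsMMSAllocation {M : Type*} {n : ℕ} (ρ : ℝ) (v : Fin n → Finset M → ℝ)
    (A : Fin n → Finset M) : Prop :=
  IsAllocation A ∧ ∀ i : Fin n, ρ * mms (v i) n ≤ v i (A i)

end FairAllocation

/-!
Ask of a set `X` of items that each of `k` agents sees in it `k` disjoint bundles worth `c` times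
what she wants. Which `c` are enough to satisfy all of them from `X`?

For one agent `c = 1` is enough, and sufficient factors add up: move the items of `X` to a new part
one by one until at least `b` agents see `b` bundles worth `d` in it. Give the part to `b` agents
that include all those who saw these bundles before the last item `e` was moved. By subadditivity
each of the other `a` agents still sees `a + 1` bundles worth `c` in the complement, and `e` lies in
at most one of them.

For three agents `c = 2` is enough. An agent `i` other than `a` accepts the complement of at least
one of two disjoint bundles of `a`, so an inclusion-minimal set accepted by someone other than `a`
can be taken outside a bundle worth `2` to `a`. Give it to someone who accepts it. By minimality it
destroys one bundle of the third agent and lowers the others by at most `1`, so two bundles worth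
`1` remain, while the whole is still worth `2` to `a`; these two agents cut and choose.

Writing `n = 3q + r` one gets the factor `2q + r = ⌈2n/3⌉`, which is at most `6` for `n ≤ 9`.
-/

namespace FairAllocation

section Valuation

variable {M : Type*} [DecidableEq M] {v : Finset M → ℝ}

theorem IsSubadditiveValuation.nonneg (hv : IsSubadditiveValuation v) (S : Finset M) : 0 ≤ v S :=
  hv.normalized.symm.le.trans (hv.monotone _ _ S.empty_subset)

theorem IsSubadditiveValuation.le_inter_add_sdiff (hv : IsSubadditiveValuation v)
    (S T : Finset M) : v S ≤ v (S ∩ T) + v (S \ T) := by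
  simpa only [Finset.union_comm (S ∩ T), Finset.sdiff_union_inter] using
    hv.subadditive (S ∩ T) (S \ T)

theorem IsSubadditiveValuation.le_sdiff_or_le_sdiff (hv : IsSubadditiveValuation v)
    {X B C : Finset M} {t : ℝ} (hBC : Disjoint B C) (hX : 2 * t ≤ v X) :
    t ≤ v (X \ B) ∨ t ≤ v (X \ C) := by
  have hsplit : v X ≤ v (X ∩ B) + v (X \ B) := hv.le_inter_add_sdiff X B
  have hdisj : Disjoint (X ∩ B) C := hBC.mono_left Finset.inter_subset_right
  have hsub : v (X ∩ B) ≤ v (X \ C) :=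
    hv.monotone _ _ (Finset.subset_sdiff.2 ⟨Finset.inter_subset_left, hdisj⟩)
  by_contra! h
  linarith

theorem mms_nonneg (hv : IsSubadditiveValuation v) (n : ℕ) : 0 ≤ mms v n :=
  Real.sSup_nonneg <| by
    rintro _ ⟨P, -, rfl⟩
    exact Real.iInf_nonneg fun j => hv.nonneg (P j)

end Valuation

section Bundles

variable {M : Type*} {v : Finset M → ℝ} {k l a b : ℕ} {c d : ℝ} {X Y S : Finset M}

/-- `X` contains `k` disjoint bundles worth at least `c` each, that is, the maximin share of `v`
among `k` agents is at least `c` when only the items of `X` are available. The bundles need not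
cover `X`. -/
def HasBundles (v : Finset M → ℝ) (k : ℕ) (c : ℝ) (X : Finset M) : Prop :=
  ∃ P : Fin k → Finset M, IsAllocation P ∧ ∀ j, P j ⊆ X ∧ c ≤ v (P j)

theorem hasBundles_mms [Fintype M] (v : Finset M → ℝ) (n : ℕ) :
    HasBundles v n (mms v n) Finset.univ := by
  rcases n.eq_zero_or_pos with rfl | hn
  · exact ⟨fun _ => ∅, fun i => i.elim0, fun i => i.elim0⟩
  · obtain ⟨P, hP, hmin⟩ := (isGreatest_mms v n hn).1
    exact ⟨P, hP.1, fun j => ⟨Finset.subset_univ _, hmin.2 ⟨j, rfl⟩⟩⟩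

theorem hasBundles_of_le_card {κ : Type*} {s : Finset κ} {p : κ → Finset M} (hs : k ≤ s.card)
    (hp : (s : Set κ).PairwiseDisjoint p) (h : ∀ j ∈ s, p j ⊆ X ∧ c ≤ v (p j)) :
    HasBundles v k c X := by
  let f : Fin k → s := fun j => s.equivFin.symm (Fin.castLE hs j)
  have hf : Function.Injective f := s.equivFin.symm.injective.comp (Fin.castLE_injective hs)
  exact ⟨fun j => p (f j), fun i j hij => hp (f i).2 (f j).2 fun h => hij (hf (Subtype.ext h)),
    fun j => h _ (f j).2⟩

theorem HasBundles.mono (h : HasBundles v k c X) (hl : l ≤ k) (hd : d ≤ c) (hXY : X ⊆ Y) :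
    HasBundles v l d Y := by
  obtain ⟨P, hP, hX⟩ := h
  exact ⟨fun j => P (Fin.castLE hl j), fun i j hij => hP _ _ ((Fin.castLE_injective hl).ne hij),
    fun j => ⟨(hX _).1.trans hXY, hd.trans (hX _).2⟩⟩

variable [DecidableEq M]

theorem HasBundles.le (hv : IsSubadditiveValuation v) (h : HasBundles v (k + 1) c X) :
    c ≤ v X := by
  obtain ⟨P, -, hX⟩ := h
  exact (hX 0).2.trans (hv.monotone _ _ (hX 0).1)

theorem HasBundles.left_or_sdiff (hv : IsSubadditiveValuation v)
    (h : HasBundles v (a + b) (c + d) X) (Z : Finset M) :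
    HasBundles v b d Z ∨ HasBundles v (a + 1) c (X \ Z) := by
  obtain ⟨P, hP, hX⟩ := h
  let inside : Finset (Fin (a + b)) := {j | d ≤ v (P j ∩ Z)}
  let outside : Finset (Fin (a + b)) := {j | c ≤ v (P j \ Z)}
  have hcover : inside ∪ outside = Finset.univ := by
    ext j
    simp only [inside, outside, Finset.mem_union, Finset.mem_filter, Finset.mem_univ, true_and,
      iff_true]
    by_contra! hj
    linarith [(hX j).2, hv.le_inter_add_sdiff (P j) Z]
  have hcard : a + b ≤ inside.card + outside.card := by
    simpa only [hcover, Finset.card_univ, Fintype.card_fin] using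
      Finset.card_union_le inside outside
  rcases le_or_gt b inside.card with hb | hb
  · refine .inl (hasBundles_of_le_card (p := fun j => P j ∩ Z) hb (fun i _ j _ hij => ?_)
      fun j hj => ?_)
    · exact (hP i j hij).mono Finset.inter_subset_left Finset.inter_subset_left
    · exact ⟨Finset.inter_subset_right, (Finset.mem_filter.1 hj).2⟩
  · have ha : a + 1 ≤ outside.card := by lia
    refine .inr (hasBundles_of_le_card (p := fun j => P j \ Z) ha (fun i _ j _ hij => ?_)
      fun j hj => ?_)
    · exact (hP i j hij).mono Finset.sdiff_subset Finset.sdiff_subset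
    · exact ⟨Finset.sdiff_subset_sdiff (hX j).1 subset_rfl, (Finset.mem_filter.1 hj).2⟩

theorem HasBundles.sdiff_of_erase_le (hv : IsSubadditiveValuation v)
    (h : HasBundles v (k + 1) (c + d) X) {e : M} (he : v (S.erase e) ≤ d) :
    HasBundles v k c (X \ S) := by
  obtain ⟨P, hP, hX⟩ := h
  have hhit : (Finset.univ.filter fun j => e ∈ P j).card ≤ 1 := by
    refine Finset.card_le_one.2 fun i hi j hj => ?_
    by_contra hij
    exact Finset.disjoint_left.1 (hP i j hij) (Finset.mem_filter.1 hi).2 (Finset.mem_filter.1 hj).2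
  have hmissed : k ≤ (Finset.univ.filter fun j => e ∉ P j).card := by
    have hcard := Finset.card_filter_add_card_filter_not (s := Finset.univ) fun j => e ∈ P j
    rw [Finset.card_univ, Fintype.card_fin] at hcard
    lia
  refine hasBundles_of_le_card (p := fun j => P j \ S) hmissed (fun i _ j _ hij => ?_)
    fun j hj => ⟨Finset.sdiff_subset_sdiff (hX j).1 subset_rfl, ?_⟩
  · exact (hP i j hij).mono Finset.sdiff_subset Finset.sdiff_subset
  · have hej : e ∉ P j := (Finset.mem_filter.1 hj).2
    have hinter : P j ∩ S ⊆ S.erase e := by grind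
    linarith [(hX j).2, hv.le_inter_add_sdiff (P j) S, hv.monotone _ _ hinter]

theorem HasBundles.sdiff_of_forall_erase_le (hv : IsSubadditiveValuation v) (hd : 0 ≤ d)
    (h : HasBundles v (k + 1) (c + d) X) (hS : ∀ e ∈ S, v (S.erase e) ≤ d) :
    HasBundles v k c (X \ S) := by
  rcases S.eq_empty_or_nonempty with rfl | ⟨e, he⟩
  · exact h.mono k.le_succ (le_add_of_nonneg_right hd) Finset.sdiff_empty.superset
  · exact h.sdiff_of_erase_le hv (hS e he)

end Bundles

section Agents

variable {M ι : Type*} {v : ι → Finset M → ℝ} {t : ι → ℝ} {I J : Finset ι} {X Y : Finset M}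
  {k a b : ℕ} {c d : ℝ}

/-- The items of `X` can be allocated to the agents of `I` so that each agent `i` gets value at
least `t i`. -/
def Satisfiable (v : ι → Finset M → ℝ) (t : ι → ℝ) (I : Finset ι) (X : Finset M) : Prop :=
  ∃ A : ι → Finset M, (I : Set ι).PairwiseDisjoint A ∧ ∀ i ∈ I, A i ⊆ X ∧ t i ≤ v i (A i)

theorem satisfiable_empty (v : ι → Finset M → ℝ) (t : ι → ℝ) (X : Finset M) :
    Satisfiable v t ∅ X :=
  ⟨fun _ => ∅, by simp, by simp⟩

theorem satisfiable_singleton {i : ι} (h : t i ≤ v i X) : Satisfiable v t {i} X :=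
  ⟨fun _ => X, by simp, by simpa using h⟩

theorem Satisfiable.mono (h : Satisfiable v t I X) (hJI : J ⊆ I) (hXY : X ⊆ Y) :
    Satisfiable v t J Y := by
  obtain ⟨A, hdisj, hA⟩ := h
  exact ⟨A, hdisj.subset (Finset.coe_subset.2 hJI),
    fun i hi => ⟨(hA i (hJI hi)).1.trans hXY, (hA i (hJI hi)).2⟩⟩

theorem Satisfiable.union [DecidableEq M] [DecidableEq ι] (hI : Satisfiable v t I X)
    (hJ : Satisfiable v t J Y) (hXY : Disjoint X Y) : Satisfiable v t (I ∪ J) (X ∪ Y) := by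
  obtain ⟨A, hAdisj, hA⟩ := hI
  obtain ⟨B, hBdisj, hB⟩ := hJ
  have hAB : ∀ i ∈ I, ∀ j ∈ J, Disjoint (A i) (B j) := fun i hi j hj =>
    hXY.mono (hA i hi).1 (hB j hj).1
  refine ⟨I.piecewise A B, fun i hi j hj hij => ?_, fun i hi => ?_⟩
  · have hi' := Finset.mem_union.1 hi
    have hj' := Finset.mem_union.1 hj
    by_cases hiI : i ∈ I <;> by_cases hjI : j ∈ I <;>
      simp only [Function.onFun, hiI, hjI, not_false_eq_true, Finset.piecewise_eq_of_mem,
        Finset.piecewise_eq_of_notMem]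
    · exact hAdisj hiI hjI hij
    · exact hAB i hiI j (hj'.resolve_left hjI)
    · exact (hAB j hjI i (hi'.resolve_left hiI)).symm
    · exact hBdisj (hi'.resolve_left hiI) (hj'.resolve_left hjI) hij
  · by_cases hiI : i ∈ I
    · rw [Finset.piecewise_eq_of_mem _ _ _ hiI]
      exact ⟨(hA i hiI).1.trans Finset.subset_union_left, (hA i hiI).2⟩
    · have hiJ : i ∈ J := (Finset.mem_union.1 hi).resolve_left hiI
      rw [Finset.piecewise_eq_of_notMem _ _ _ hiI]
      exact ⟨(hB i hiJ).1.trans Finset.subset_union_right, (hB i hiJ).2⟩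

/-- Any `k` agents who each see in a set `X` at least `k` disjoint bundles worth `c` times their
target `t i` can all reach their targets with items of `X`. -/
def IsSufficientFactor (v : ι → Finset M → ℝ) (t : ι → ℝ) (k : ℕ) (c : ℝ) : Prop :=
  ∀ (I : Finset ι) (X : Finset M), I.card = k → (∀ i ∈ I, HasBundles (v i) k (c * t i) X) →
    Satisfiable v t I X

theorem isSufficientFactor_zero (v : ι → Finset M → ℝ) (t : ι → ℝ) (c : ℝ) :
    IsSufficientFactor v t 0 c := by
  intro I X hI _
  rw [Finset.card_eq_zero.1 hI]
  exact satisfiable_empty v t X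

theorem IsSufficientFactor.mono (ht : ∀ i, 0 ≤ t i) (h : IsSufficientFactor v t k c)
    (hcd : c ≤ d) : IsSufficientFactor v t k d := fun I X hI hX =>
  h I X hI fun i hi => (hX i hi).mono le_rfl (mul_le_mul_of_nonneg_right hcd (ht i)) subset_rfl

variable [DecidableEq M]

theorem isSufficientFactor_one (hv : ∀ i, IsSubadditiveValuation (v i)) (t : ι → ℝ) :
    IsSufficientFactor v t 1 1 := by
  intro I X hI hX
  obtain ⟨i, rfl⟩ := Finset.card_eq_one.1 hI
  exact satisfiable_singleton (by simpa using (hX i (Finset.mem_singleton_self i)).le (hv i))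

theorem exists_hasBundles_hasBundles_sdiff [DecidableEq ι]
    (hv : ∀ i, IsSubadditiveValuation (v i)) (ht : ∀ i, 0 ≤ t i) (hc : 0 ≤ c) (hd : 0 ≤ d)
    (hI : b ≤ I.card) (hX : ∀ i ∈ I, HasBundles (v i) (a + b) ((c + d) * t i) X) :
    ∃ Y ⊆ X, ∃ J ⊆ I, J.card = b ∧ (∀ i ∈ J, HasBundles (v i) b (d * t i) Y) ∧
      ∀ i ∈ I \ J, HasBundles (v i) a (c * t i) (X \ Y) := by
  classical
  let T : Finset M → Finset ι := fun Y => {i ∈ I | HasBundles (v i) b (d * t i) Y}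
  have hTX : b ≤ (T X).card := by
    rwa [show T X = I from Finset.filter_true_of_mem fun i hi => (hX i hi).mono (b.le_add_left a)
      (mul_le_mul_of_nonneg_right (le_add_of_nonneg_left hc) (ht i)) subset_rfl]
  obtain ⟨Y, hYX, hY⟩ := exists_minimal_le_of_wellFoundedLT (fun Y => b ≤ (T Y).card) X hTX
  rcases Y.eq_empty_or_nonempty with rfl | ⟨e, he⟩
  · obtain ⟨J, hJT, hJ⟩ := Finset.exists_subset_card_eq hY.prop
    refine ⟨∅, hYX, J, hJT.trans (Finset.filter_subset _ _), hJ,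
      fun i hi => (Finset.mem_filter.1 (hJT hi)).2, fun i hi => ?_⟩
    exact (hX i (Finset.mem_sdiff.1 hi).1).mono (a.le_add_right b)
      (mul_le_mul_of_nonneg_right (le_add_of_nonneg_right hd) (ht i)) Finset.sdiff_empty.superset
  · have hfew : (T (Y.erase e)).card < b :=
      not_le.1 (hY.not_prop_of_lt (Finset.erase_ssubset he))
    have hTY : T (Y.erase e) ⊆ T Y := Finset.monotone_filter_right I fun i _ h =>
      h.mono le_rfl le_rfl (Y.erase_subset e)
    obtain ⟨J, hTJ, hJT, hJ⟩ := Finset.exists_subsuperset_card_eq hTY hfew.le hY.prop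
    refine ⟨Y, hYX, J, hJT.trans (Finset.filter_subset _ _), hJ,
      fun i hi => (Finset.mem_filter.1 (hJT hi)).2, fun i hi => ?_⟩
    obtain ⟨hiI, hiJ⟩ := Finset.mem_sdiff.1 hi
    have hreject : ¬HasBundles (v i) b (d * t i) (Y.erase e) := fun h =>
      hiJ (hTJ (Finset.mem_filter.2 ⟨hiI, h⟩))
    have hrest : HasBundles (v i) (a + 1) (c * t i + 0) (X \ Y.erase e) := by
      rw [add_zero]
      exact (((add_mul c d (t i)) ▸ hX i hiI).left_or_sdiff (hv i) _).resolve_left hreject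
    have hYe : (X \ Y.erase e) \ {e} = X \ Y := by grind
    rw [← hYe]
    exact hrest.sdiff_of_erase_le (e := e) (hv i) (by simp [(hv i).normalized])

theorem IsSufficientFactor.add (hv : ∀ i, IsSubadditiveValuation (v i)) (ht : ∀ i, 0 ≤ t i)
    (hc : 0 ≤ c) (hd : 0 ≤ d) (ha : IsSufficientFactor v t a c)
    (hb : IsSufficientFactor v t b d) : IsSufficientFactor v t (a + b) (c + d) := by
  classical
  intro I X hI hX
  obtain ⟨Y, hYX, J, hJI, hJ, hJY, hIJ⟩ :=
    exists_hasBundles_hasBundles_sdiff hv ht hc hd (hI ▸ b.le_add_left a) hX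
  have hcard : (I \ J).card = a := by rw [Finset.card_sdiff_of_subset hJI, hI, hJ]; lia
  have hunion := (hb J Y hJ hJY).union (ha (I \ J) (X \ Y) hcard hIJ) Finset.disjoint_sdiff
  rwa [Finset.union_sdiff_of_subset hJI, Finset.union_sdiff_of_subset hYX] at hunion

theorem IsSufficientFactor.mul (hv : ∀ i, IsSubadditiveValuation (v i)) (ht : ∀ i, 0 ≤ t i)
    (hc : 0 ≤ c) (h : IsSufficientFactor v t k c) (q : ℕ) :
    IsSufficientFactor v t (q * k) (q * c) := by
  induction q with
  | zero => simpa using isSufficientFactor_zero v t 0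
  | succ q ih =>
    rw [Nat.succ_mul, Nat.cast_succ, add_one_mul]
    exact ih.add hv ht (by positivity) hc h

theorem exists_subset_le_forall_hasBundles_sdiff (hv : ∀ i, IsSubadditiveValuation (v i))
    (ht : ∀ i, 0 ≤ t i) (h : ∃ i ∈ I, t i ≤ v i Y) :
    ∃ S ⊆ Y, ∃ i ∈ I, t i ≤ v i S ∧ ∀ j ∈ I, ∀ (k : ℕ) (c : ℝ) (X : Finset M),
      HasBundles (v j) (k + 1) (c + t j) X → HasBundles (v j) k c (X \ S) := by
  obtain ⟨S, hSY, hS⟩ :=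
    exists_minimal_le_of_wellFoundedLT (fun S => ∃ i ∈ I, t i ≤ v i S) Y h
  obtain ⟨i, hi, hiS⟩ := hS.prop
  refine ⟨S, hSY, i, hi, hiS, fun j hj k c X hX => ?_⟩
  refine hX.sdiff_of_forall_erase_le (hv j) (ht j) fun e he => ?_
  by_contra! hlt
  exact hS.not_prop_of_lt (Finset.erase_ssubset he) ⟨j, hj, hlt.le⟩

theorem satisfiable_pair_of_hasBundles [DecidableEq ι] (hv : ∀ i, IsSubadditiveValuation (v i))
    {i j : ι} (hi : 2 * t i ≤ v i X) (hj : HasBundles (v j) 2 (t j) X) :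
    Satisfiable v t {i, j} X := by
  obtain ⟨P, hP, hX⟩ := hj
  obtain ⟨m, hm⟩ : ∃ m, t i ≤ v i (X \ P m) :=
    ((hv i).le_sdiff_or_le_sdiff (hP 0 1 zero_ne_one) hi).elim (⟨0, ·⟩) (⟨1, ·⟩)
  have hunion := (satisfiable_singleton hm).union (satisfiable_singleton (hX m).2)
    Finset.sdiff_disjoint
  rwa [Finset.sdiff_union_of_subset (hX m).1] at hunion

theorem isSufficientFactor_three (hv : ∀ i, IsSubadditiveValuation (v i)) (ht : ∀ i, 0 ≤ t i) :
    IsSufficientFactor v t 3 2 := by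
  classical
  intro I X hI hX
  obtain ⟨a, ha⟩ : I.Nonempty := Finset.card_pos.1 (by lia)
  obtain ⟨i, hi⟩ : (I.erase a).Nonempty :=
    Finset.card_pos.1 (by rw [Finset.card_erase_of_mem ha]; lia)
  obtain ⟨B, hBX, haB, hiB⟩ : ∃ B ⊆ X, 2 * t a ≤ v a B ∧ t i ≤ v i (X \ B) := by
    obtain ⟨P, hP, hPX⟩ := hX a ha
    exact ((hv i).le_sdiff_or_le_sdiff (hP 0 1 (by decide))
      ((hX i (Finset.mem_of_mem_erase hi)).le (hv i))).elim
      (fun h => ⟨P 0, (hPX 0).1, (hPX 0).2, h⟩) (fun h => ⟨P 1, (hPX 1).1, (hPX 1).2, h⟩)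
  obtain ⟨S, hS, d, hd, hdS, hbundles⟩ :=
    exists_subset_le_forall_hasBundles_sdiff hv ht ⟨i, hi, hiB⟩
  obtain ⟨b, hb⟩ : ∃ b, (I.erase a).erase d = {b} := Finset.card_eq_one.1 (by
    rw [Finset.card_erase_of_mem hd, Finset.card_erase_of_mem ha, hI])
  have hbI : b ∈ I.erase a :=
    Finset.mem_of_mem_erase (hb.symm ▸ Finset.mem_singleton_self b : b ∈ (I.erase a).erase d)
  have haS : 2 * t a ≤ v a (X \ S) := haB.trans <| (hv a).monotone _ _ <|
    Finset.subset_sdiff.2 ⟨hBX, (Finset.subset_sdiff.1 hS).2.symm⟩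
  have hbS : HasBundles (v b) 2 (t b) (X \ S) :=
    hbundles b hbI 2 (t b) X (two_mul (t b) ▸ hX b (Finset.mem_of_mem_erase hbI))
  exact ((satisfiable_singleton hdS).union (satisfiable_pair_of_hasBundles hv haS hbS)
    Finset.disjoint_sdiff).mono (by grind) (by grind)

theorem isSufficientFactor_of_two_mul_le (hv : ∀ i, IsSubadditiveValuation (v i))
    (ht : ∀ i, 0 ≤ t i) {m : ℕ} (h : 2 * k ≤ 3 * m) : IsSufficientFactor v t k m := by
  have hsum := ((isSufficientFactor_three hv ht).mul hv ht zero_le_two (k / 3)).add hv ht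
    (by positivity) (by positivity) ((isSufficientFactor_one hv t).mul hv ht zero_le_one (k % 3))
  rw [mul_one (k % 3), Nat.div_add_mod'] at hsum
  refine hsum.mono ht ?_
  have hm : k / 3 * 2 + k % 3 * 1 ≤ m := by lia
  exact_mod_cast hm

end Agents

end FairAllocation

open FairAllocation in
theorem mainTheorem6_general {M : Type*} [Finite M] [DecidableEq M] {n c : ℕ}
    (hc : 2 * n ≤ 3 * c) {v : Fin n → Finset M → ℝ}
    (hv : ∀ i : Fin n, IsSubadditiveValuation (v i)) :
    ∃ A : Fin n → Finset M, IsMMSAllocation (1 / c) v A := by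
  cases nonempty_fintype M
  let t : Fin n → ℝ := fun i => 1 / c * mms (v i) n
  have ht : ∀ i, 0 ≤ t i := fun i => mul_nonneg (by positivity) (mms_nonneg (hv i) n)
  have hbundles : ∀ i, HasBundles (v i) n (c * t i) Finset.univ := by
    intro i
    have hc0 : (c : ℝ) ≠ 0 := Nat.cast_ne_zero.2 (by have := i.pos; lia)
    rw [← mul_assoc, mul_one_div_cancel hc0, one_mul]
    exact hasBundles_mms (v i) n
  obtain ⟨A, hdisj, hA⟩ := isSufficientFactor_of_two_mul_le hv ht hc Finset.univ Finset.univ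
    (Finset.card_fin n) fun i _ => hbundles i
  exact ⟨A, fun i j hij => hdisj (Finset.mem_coe.2 (Finset.mem_univ i))
    (Finset.mem_coe.2 (Finset.mem_univ j)) hij, fun i => (hA i (Finset.mem_univ i)).2⟩

theorem mainTheorem6 {M : Type*} [Fintype M] [DecidableEq M] (n : ℕ) (hn : n ≤ 8)
    (v : Fin n → Finset M → ℝ)
    (hv : ∀ i : Fin n, FairAllocation.IsSubadditiveValuation (v i)) :
    ∃ A : Fin n → Finset M, FairAllocation.IsMMSAllocation (1 / 6) v A :=
  mod_cast mainTheorem6_general (c := 6) (by lia) hv
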